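/- Let $\Bbbk$ be a field of characteristic $0$ and let $(\mathfrak g=\bigoplus_{i\in\mathbb Z}\mathfrak g^i,d,[\,,])$ be a differential graded Lie algebra over $\Bbbk$ of deformation type: $\mathfrak g^i=0$ for $i<-1$ and $d$ vanishes on $\mathfrak g^{-1}$. (Examples are the polyvector fields $\mathcal T_{poly}^{\cdot}[1](M)$ and the polydifferential operators $\mathcal D_{poly}^{\cdot}[1](M)$ of a manifold $M$.) Assume that $\mathfrak g$ carries a Hausdorff additive group topology for which each $\mathfrak g^i$ is closed, $d$ is continuous and every map $[a,-]$ is continuous (for instance the discrete or an $\hbar$-adic topology). Regard $\mathfrak g$ as an $L_\infty$-algebra with structure maps $D_1=d$ and $D_2(a,b)=(-1)^{|a|-1}[a,b]$ on $\mathfrak g[1]$. Let $\mathscr X=\{X_n\}_{n\ge1}$ be an $L_\infty$-derivation of $\mathfrak g$: a coderivation of degree $0$ of the free graded cocommutative coalgebra on $\mathfrak g[1]$, with Taylor coefficients $X_n$ (graded symmetric multilinear maps of degree $0$ on $\mathfrak g[1]$, i.e. of degree $1-n$ on $\mathfrak g$), which commutes with the codifferential $D$. Let $\pi\in\mathfrak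 g^1$ be a Maurer-Cartan element, $d\pi+\frac12[\pi,\pi]=0$, and suppose that all the series $$\mathscr X(\pi)=\sum_{n\ge1}\frac1{n!}X_n(\pi,\dots,\pi),\qquad \mathscr X_{\pi,n}(a_1,\dots,a_n)=\sum_{p\ge0}\frac1{p!}X_{n+p}(a_1,\dots,a_n,\underbrace{\pi,\dots,\pi}_{p})\quad(n\ge1,\ a_i\in\mathfrak g)$$ converge. Suppose that $\mathscr X$ satisfies the strong Nijenhuis condition with respect to $\pi$: for all $n\ge1$, $\mathscr X_{\pi,n}(a_1,\dots,a_n)=0$ whenever $a_i=\mathscr X(\pi)$ for some $i$. Put $d_\pi a=da+[\pi,a]$ and $\{x,y\}=[x,[\pi,y]]$. Let $f,g\in\mathfrak g^{-1}$ with $d_\pi f=0=d_\pi g$, let $k,l\ge0$ be integers, and let $x=\mathscr X_{\pi,1}^k(f)$ and $y=\mathscr X_{\pi,1}^l(g)$. Then $$\mathscr X_{\pi,1}(\{x,y\})=\{\mathscr X_{\pi,1}(x),y\}+\{x,\mathscr X_{\pi,1}(y)\}+[x,[\mathscr X(\pi),y]]$$ and $$\mathscr X_{\pi,1}([x,[\mathscr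 X(\pi),y]])=[\mathscr X_{\pi,1}(x),[\mathscr X(\pi),y]]+[x,[\mathscr X(\pi),\mathscr X_{\pi,1}(y)]].$$ -/

import Mathlib

/-- A differential graded Lie algebra over `𝕜`, in cohomological grading: the underlying space `L`
is the direct sum of its homogeneous pieces `gr i`, `i : ℤ`, the differential `d` has degree `+1`,
the bracket `br` has degree `0` and obeys the graded antisymmetry, Jacobi and Leibniz rules. -/
structure DGLieAlgebra (𝕜 : Type*) (L : Type*) [Field 𝕜] [AddCommGroup L] [Module 𝕜 L] where
  /-- the homogeneous pieces -/
  gr : ℤ → Submodule 𝕜 L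
  isInternal : DirectSum.IsInternal gr
  /-- the differential -/
  d : L →ₗ[𝕜] L
  /-- the Lie bracket -/
  br : L →ₗ[𝕜] L →ₗ[𝕜] L
  d_mem : ∀ {i : ℤ} {a : L}, a ∈ gr i → d a ∈ gr (i + 1)
  br_mem : ∀ {i j : ℤ} {a b : L}, a ∈ gr i → b ∈ gr j → br a b ∈ gr (i + j)
  d_d : ∀ a : L, d (d a) = 0
  br_skew : ∀ {i j : ℤ} {a b : L}, a ∈ gr i → b ∈ gr j →
    br a b = -((i * j).negOnePow • br b a)
  jacobi : ∀ {i j : ℤ} {a b : L} (c : L), a ∈ gr i → b ∈ gr j →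
    br a (br b c) = br (br a b) c + (i * j).negOnePow • br b (br a c)
  leibniz : ∀ {i : ℤ} {a : L} (b : L), a ∈ gr i →
    d (br a b) = br (d a) b + i.negOnePow • br a (d b)

namespace DGLieAlgebra

variable {𝕜 : Type*} {L : Type*} [Field 𝕜] [AddCommGroup L] [Module 𝕜 L]

/-- The shape of the DG Lie algebras of deformation theory (polyvector fields, polydifferential
operators, with degrees shifted by one): the grading begins in degree `-1`, and the differential
vanishes on the lowest degree. (Elements of degree `-1` then commute, as `gr (-2) = ⊥`.) -/
structure IsDeformation (G : DGLieAlgebra 𝕜 L) : Prop where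
  gr_eq_bot : ∀ i : ℤ, i < -1 → G.gr i = ⊥
  d_eq_zero : ∀ a ∈ G.gr (-1), G.d a = 0

/-- Compatibility of the DG Lie algebra with a topology on `L`, in which infinite series are
evaluated: the homogeneous pieces are closed, the differential is continuous and the bracket is
separately continuous. The discrete topology and the `ħ`-adic topology are examples. -/
structure IsTopological [TopologicalSpace L] (G : DGLieAlgebra 𝕜 L) : Prop where
  isClosed_gr : ∀ i : ℤ, IsClosed (G.gr i : Set L)
  continuous_d : Continuous G.d
  continuous_br : ∀ a : L, Continuous (G.br a)

/-- Maurer-Cartan elements: `dπ + ½ [π, π] = 0`, with `π` of degree `1`. -/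
def IsMaurerCartan (G : DGLieAlgebra 𝕜 L) (π : L) : Prop :=
  π ∈ G.gr 1 ∧ G.d π + (2⁻¹ : 𝕜) • G.br π π = 0

/-- The twisted differential `d_π a = da + [π, a]`. -/
def dTwist (G : DGLieAlgebra 𝕜 L) (π a : L) : L :=
  G.d a + G.br π a

/-- The bracket `{x, y} = [x, [π, y]]` defined by `π` (on elements of degree `-1`). -/
def poisson (G : DGLieAlgebra 𝕜 L) (π x y : L) : L :=
  G.br x (G.br π y)

/-- The second structure map `D₂` of the `L∞`-algebra attached to `G`, as a graded symmetric map of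
degree `1` on the shifted space `L[1]`, where an element of degree `i` of `L` has degree `i - 1`:
`D₂(a, b) = (-1)^(i - 1) [a, b]` for `a` of degree `i`. The first structure map is `D₁ = d`, and
the higher ones vanish. With this sign `D₁ + D₂` squares to zero as a coderivation and
`D₁ π + ½ D₂(π, π) = dπ + ½ [π, π]` for `π` of degree `1`. -/
def D₂ (G : DGLieAlgebra 𝕜 L) (i : ℤ) (a b : L) : L :=
  (i - 1).negOnePow • G.br a b

end DGLieAlgebra

/-! Koszul signs. For homogeneous `a₀, …, aₙ` of degrees `deg 0, …, deg n` in `L`, hence of degrees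
`deg k - 1` in `L[1]`: -/

/-- the sign for moving an operator of degree `1` past `a₀, …, aᵢ₋₁`; -/
def koszulOp {n : ℕ} (deg : Fin n → ℤ) (i : Fin n) : ℤˣ :=
  (∑ k ∈ Finset.Iio i, (deg k - 1)).negOnePow

/-- the sign for moving `aᵢ` in front of the other arguments; -/
def koszulOne {n : ℕ} (deg : Fin n → ℤ) (i : Fin n) : ℤˣ :=
  ((deg i - 1) * ∑ k ∈ Finset.Iio i, (deg k - 1)).negOnePow

/-- the sign for moving `aᵢ, aⱼ` (in this order, `i < j`) in front of the other arguments. -/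
def koszulTwo {n : ℕ} (deg : Fin n → ℤ) (i j : Fin n) : ℤˣ :=
  ((deg i - 1) * ∑ k ∈ Finset.Iio i, (deg k - 1) +
    (deg j - 1) * ∑ k ∈ (Finset.Iio j).erase i, (deg k - 1)).negOnePow

/-- An `L∞`-derivation `𝒳 = {Xₙ}ₙ≥₁` of a DG Lie algebra, given by its Taylor coefficients: a
coderivation of degree `0` of the free graded cocommutative coalgebra on `L[1]` is the same thing as
a family of graded symmetric multilinear maps `Xₙ` on `L[1]` of degree `0` (as maps on `L` they have
degree `1 - n`). The last two fields are the components with `1` and with `n + 2` arguments of the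
equation `D ∘ 𝒳 = 𝒳 ∘ D`, for `D` the codifferential with Taylor coefficients `D₁ = d` and `D₂`.
The index `n = 0` is not used: `X₀ = 0`. -/
structure LInftyDerivation {𝕜 : Type*} {L : Type*} [Field 𝕜] [AddCommGroup L] [Module 𝕜 L]
    (G : DGLieAlgebra 𝕜 L) where
  /-- the Taylor coefficients -/
  X : (n : ℕ) → MultilinearMap 𝕜 (fun _ : Fin n => L) L
  X_zero : X 0 = 0
  X_mem : ∀ (n : ℕ) (deg : Fin n → ℤ) (a : Fin n → L), (∀ i, a i ∈ G.gr (deg i)) →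
    X n a ∈ G.gr ((∑ i, deg i) + 1 - n)
  X_symm : ∀ (n : ℕ) (deg : Fin n → ℤ) (a : Fin n → L), (∀ i, a i ∈ G.gr (deg i)) →
    ∀ i j : Fin n, (i : ℕ) + 1 = j →
      X n (a ∘ Equiv.swap i j) = ((deg i - 1) * (deg j - 1)).negOnePow • X n a
  comm_one : ∀ a : L, G.d (X 1 ![a]) = X 1 ![G.d a]
  comm : ∀ (n : ℕ) (deg : Fin (n + 2) → ℤ) (a : Fin (n + 2) → L), (∀ i, a i ∈ G.gr (deg i)) →
    G.d (X (n + 2) a)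
      + ∑ i, koszulOne deg i • G.D₂ (deg i) (a i) (X (n + 1) (i.removeNth a)) =
    ∑ i, koszulOp deg i • X (n + 2) (Function.update a i (G.d (a i)))
      + ∑ j : Fin (n + 2), ∑ i : Fin (n + 1), if i.castSucc < j then
          koszulTwo deg i.castSucc j •
            X (n + 1) (Fin.cons (G.D₂ (deg i.castSucc) (a i.castSucc) (a j))
              (i.removeNth (j.removeNth a)))
        else 0

namespace LInftyDerivation

variable {𝕜 : Type*} {L : Type*} [Field 𝕜] [AddCommGroup L] [Module 𝕜 L]
  {G : DGLieAlgebra 𝕜 L}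

/-- The terms `1/n! Xₙ(π, …, π)` of the series `𝒳(π)`. -/
noncomputable def valueTerm (𝒳 : LInftyDerivation G) (π : L) (n : ℕ) : L :=
  ((n.factorial : 𝕜)⁻¹) • 𝒳.X n (fun _ => π)

/-- The terms `1/p! Xₙ₊ₚ(a₁, …, aₙ, π, …, π)` of the series `𝒳_{π,n}(a₁, …, aₙ)`. -/
noncomputable def twistTerm (𝒳 : LInftyDerivation G) (π : L) (n : ℕ) (a : Fin n → L) (p : ℕ) : L :=
  ((p.factorial : 𝕜)⁻¹) • 𝒳.X (n + p) (Fin.append a (fun _ : Fin p => π))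

variable [TopologicalSpace L]

/-- The series defining `𝒳(π)` and all `𝒳_{π,n}(a₁, …, aₙ)` converge (as limits of their partial
sums). -/
structure Converges (𝒳 : LInftyDerivation G) (π : L) : Prop where
  eval : Summable (𝒳.valueTerm π) (SummationFilter.conditional ℕ)
  twist : ∀ (n : ℕ), 1 ≤ n → ∀ a : Fin n → L,
    Summable (𝒳.twistTerm π n a) (SummationFilter.conditional ℕ)

/-- `𝒳(π) = ∑_{n ≥ 1} 1/n! Xₙ(π, …, π)`; the term `n = 0` is zero. -/
noncomputable def eval (𝒳 : LInftyDerivation G) (π : L) : L :=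
  ∑'[SummationFilter.conditional ℕ] n, 𝒳.valueTerm π n

/-- `𝒳_{π,n}(a₁, …, aₙ) = ∑_{p ≥ 0} 1/p! Xₙ₊ₚ(a₁, …, aₙ, π, …, π)`. -/
noncomputable def twist (𝒳 : LInftyDerivation G) (π : L) (n : ℕ) (a : Fin n → L) : L :=
  ∑'[SummationFilter.conditional ℕ] p, 𝒳.twistTerm π n a p

/-- The linear Taylor coefficient `𝒳_{π,1}`. -/
noncomputable def twistOne (𝒳 : LInftyDerivation G) (π a : L) : L :=
  𝒳.twist π 1 ![a]

/-- The (strong) Nijenhuis condition: `𝒳_{π,n}(a₁, …, aₙ) = 0` as soon as some `aᵢ` is `𝒳(π)`. -/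
def IsStrongNijenhuis (𝒳 : LInftyDerivation G) (π : L) : Prop :=
  ∀ (n : ℕ) (a : Fin n → L), (∃ i, a i = 𝒳.eval π) → 𝒳.twist π n a = 0

end LInftyDerivation

/-!
Write `D_π` for the codifferential with Taylor coefficients `d_π` and `D₂`, and `𝒳_π` for the
coderivation with Taylor coefficients `𝒳(π), 𝒳_{π,1}, 𝒳_{π,2}, …`. The theorem follows from a few
components of the equation `D_π ∘ 𝒳_π = 𝒳_π ∘ D_π`, into which `𝒳(π)` is inserted as an argument.

That equation is the equation `D ∘ 𝒳 = 𝒳 ∘ D` for the arguments `a₁, …, aₙ, π, …, π`, multiplied by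
`1/p!` and summed over the number `p` of arguments `π`: the terms with an operation on one `π`
acquire the factor `p`, those with a bracket of two of them the factor `p (p - 1) / 2`, and the
Maurer-Cartan equation cancels the latter against the terms containing `dπ`. Only arguments of
which all but the first have even degree in `L[1]` are needed, and for these nearly all Koszul signs
disappear (`LInftyDerivation.comm_list`). The arguments are kept in lists, which avoids casts
between the types `Fin n`; sums over one or two picked arguments are `pickSum` and `pairSum`. The
results are `Converges.dTwist_eval`, that is `d_π 𝒳(π) = 0`, and `Converges.comm_twistList`.

Let `Q = [𝒳(π), -]`. By the Nijenhuis condition, inserting `𝒳(π)` yields `Q ∘ Q = 0`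
(`br_eval_eval`), `𝒳_{π,1} ∘ Q = Q ∘ 𝒳_{π,1}` in degree `-1` (`twistOne_br_eval`) and, `𝒳_{π,2}`
being zero on `𝔤⁰ × 𝔤⁻¹` for degree reasons, `𝒳_{π,2}(Q u, Q v) = 0`
(`twistList_br_eval_br_eval`). The component with one argument says that the commutator of
`𝒳_{π,1}` and `d_π` is `Q`, so by induction `d_π x` and `d_π y` have the form `Q u` and `Q v`
(`exists_dTwist_iterate_eq`). In the component with the two arguments `x` and `w`, where `w` is
`d_π y` or `Q y`, the terms with `𝒳_{π,2}` therefore all vanish, and what remains says that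
`𝒳_{π,1}[x, w] = [𝒳_{π,1} x, w] + [x, 𝒳_{π,1} w]` (`twistOne_br`). Commuting `𝒳_{π,1}` with `d_π`,
respectively with `Q`, turns this into the two identities.
-/

/-! ### Sums over picked entries of a list -/

section PickSum

variable {α M : Type*} [AddCommGroup M]

/-- The sum of `F y r` over all ways of picking an entry `y` of a list, with `r` the list of the
remaining entries. -/
def pickSum : (α → List α → M) → List α → M
  | _, [] => 0
  | F, x :: l => F x l + pickSum (fun y r => F y (x :: r)) l

/-- The sum of `F u v r` over all ways of picking two entries `u, v` of a list, `u` standing before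
`v`, with `r` the list of the remaining entries. -/
def pairSum : (α → α → List α → M) → List α → M
  | _, [] => 0
  | F, x :: l => pickSum (F x) l + pairSum (fun u v r => F u v (x :: r)) l

theorem ofFn_removeNth_succ {n : ℕ} (v : Fin (n + 2) → α) (i : Fin (n + 1)) :
    List.ofFn (i.succ.removeNth v) = v 0 :: List.ofFn (i.removeNth fun k => v k.succ) := by
  rw [List.ofFn_succ]
  simp only [Fin.removeNth, Fin.succ_succAbove_zero, Fin.succ_succAbove_succ]
  rfl

theorem ofFn_removeNth_zero {n : ℕ} (v : Fin (n + 1) → α) :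
    List.ofFn ((0 : Fin (n + 1)).removeNth v) = List.ofFn fun k => v k.succ := by
  rw [Fin.removeNth_zero]
  rfl

theorem sum_removeNth_eq_pickSum {n : ℕ} (v : Fin (n + 1) → α) (F : α → List α → M) :
    ∑ i, F (v i) (List.ofFn (i.removeNth v)) = pickSum F (List.ofFn v) := by
  induction n generalizing F with
  | zero => simp [List.ofFn_succ, pickSum]
  | succ n ih =>
    rw [Fin.sum_univ_succ, List.ofFn_succ (f := v), pickSum, ← ih]
    simp only [ofFn_removeNth_zero, ofFn_removeNth_succ]

/-- A sum over pairs `i < j`, in the form used for `L∞`-derivations, split according to whether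
`i = 0`. -/
theorem sum_pairs_succ {n : ℕ} (H : Fin (n + 1) → Fin (n + 2) → M) :
    (∑ j : Fin (n + 2), ∑ i : Fin (n + 1), if i.castSucc < j then H i j else 0) =
      ∑ j : Fin (n + 1), H 0 j.succ +
        ∑ j : Fin (n + 1), ∑ i : Fin n, if i.castSucc < j then H i.succ j.succ else 0 := by
  rw [Fin.sum_univ_succ]
  simp only [Fin.not_lt_zero, if_false, Finset.sum_const_zero, zero_add]
  rw [← Finset.sum_add_distrib]
  refine Finset.sum_congr rfl fun j _ => ?_
  rw [Fin.sum_univ_succ, Fin.castSucc_zero, if_pos (Fin.succ_pos j)]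
  simp only [← Fin.succ_castSucc, Fin.succ_lt_succ_iff]

theorem sum_removeNth_eq_pairSum {n : ℕ} (v : Fin (n + 2) → α) (F : α → α → List α → M) :
    (∑ j : Fin (n + 2), ∑ i : Fin (n + 1), if i.castSucc < j then
      F (v i.castSucc) (v j) (List.ofFn (i.removeNth (j.removeNth v))) else 0) =
      pairSum F (List.ofFn v) := by
  induction n generalizing F with
  | zero =>
    rw [sum_pairs_succ]
    simp [List.ofFn_succ, pairSum, pickSum]
  | succ n ih =>
    rw [sum_pairs_succ, List.ofFn_succ (f := v), pairSum, ← ih, ← sum_removeNth_eq_pickSum]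
    congr 1
    · refine Finset.sum_congr rfl fun j _ => ?_
      rw [ofFn_removeNth_zero]
      congr 2
      funext k
      simp [Fin.removeNth]
    · refine Finset.sum_congr rfl fun j _ => Finset.sum_congr rfl fun i _ => ?_
      rw [ofFn_removeNth_succ, ← Fin.succ_castSucc]
      congr 4
      funext k
      simp [Fin.removeNth]

theorem pickSum_congr {F F' : α → List α → M} {l : List α}
    (h : ∀ y ∈ l, ∀ r, r ⊆ l → F y r = F' y r) : pickSum F l = pickSum F' l := by
  induction l generalizing F F' with
  | nil => rfl
  | cons x l ih =>
    rw [pickSum, pickSum, h x (by simp) l (by simp),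
      ih fun y hy r hr => h y (by simp [hy]) _ (List.cons_subset_cons x hr)]

theorem pickSum_add (F F' : α → List α → M) (l : List α) :
    pickSum (fun y r => F y r + F' y r) l = pickSum F l + pickSum F' l := by
  induction l generalizing F F' with
  | nil => simp [pickSum]
  | cons x l ih => simp only [pickSum, ih]; abel

theorem map_pickSum {N : Type*} [AddCommGroup N] (φ : M →+ N) (F : α → List α → M) (l : List α) :
    φ (pickSum F l) = pickSum (fun y r => φ (F y r)) l := by
  induction l generalizing F with
  | nil => simp [pickSum]
  | cons x l ih => simp only [pickSum, map_add, ih]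

theorem map_pairSum {N : Type*} [AddCommGroup N] (φ : M →+ N) (F : α → α → List α → M)
    (l : List α) : φ (pairSum F l) = pairSum (fun u v r => φ (F u v r)) l := by
  induction l generalizing F with
  | nil => simp [pairSum]
  | cons x l ih => simp only [pairSum, map_add, map_pickSum, ih]

theorem smul_pickSum {𝕜 : Type*} [Field 𝕜] [Module 𝕜 M] (c : 𝕜) (F : α → List α → M) (l : List α) :
    c • pickSum F l = pickSum (fun y r => c • F y r) l :=
  map_pickSum (DistribSMul.toAddMonoidHom M c) F l

theorem smul_pairSum {𝕜 : Type*} [Field 𝕜] [Module 𝕜 M] (c : 𝕜) (F : α → α → List α → M) (l : List α) :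
    c • pairSum F l = pairSum (fun u v r => c • F u v r) l :=
  map_pairSum (DistribSMul.toAddMonoidHom M c) F l

theorem pickSum_append (F : α → List α → M) (b c : List α) :
    pickSum F (b ++ c) =
      pickSum (fun y r => F y (r ++ c)) b + pickSum (fun y r => F y (b ++ r)) c := by
  induction b generalizing F with
  | nil => simp [pickSum]
  | cons x b ih => simp only [List.cons_append, pickSum, ih]; abel

theorem pairSum_append (F : α → α → List α → M) (b c : List α) :
    pairSum F (b ++ c) =
      pairSum (fun u v r => F u v (r ++ c)) b +
        pickSum (fun u r => pickSum (fun v r' => F u v (r ++ r')) c) b +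
          pairSum (fun u v r => F u v (b ++ r)) c := by
  induction b generalizing F with
  | nil => simp [pickSum, pairSum]
  | cons x b ih => simp only [List.cons_append, pickSum, pairSum, pickSum_append, ih]; abel

theorem pickSum_replicate (F : α → List α → M) (x : α) (p : ℕ) :
    pickSum F (List.replicate p x) = p • F x (List.replicate (p - 1) x) := by
  induction p generalizing F with
  | zero => simp [pickSum]
  | succ p ih =>
    rw [List.replicate_succ, pickSum, ih]
    cases p with
    | zero => simp
    | succ p => simp [← List.replicate_succ, add_smul]; abel

theorem pairSum_replicate (F : α → α → List α → M) (x : α) (p : ℕ) :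
    pairSum F (List.replicate p x) = p.choose 2 • F x x (List.replicate (p - 2) x) := by
  induction p generalizing F with
  | zero => simp [pairSum]
  | succ p ih =>
    rw [List.replicate_succ, pairSum, ih, pickSum_replicate]
    match p with
    | 0 => simp
    | 1 => simp
    | p + 2 =>
      simp only [Nat.add_sub_cancel, ← List.replicate_succ]
      rw [Nat.choose_succ_succ' (p + 2) 1, Nat.choose_one_right,
        add_smul (p + 2)]
      rfl

end PickSum

/-! ### Koszul signs and lists of arguments -/

theorem Int.negOnePow_smul_self {M : Type*} [AddCommGroup M] (m : ℤ) (x : M) :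
    m.negOnePow • m.negOnePow • x = x := by
  rw [smul_smul, Int.units_mul_self, one_smul]

namespace DGLieAlgebra

variable {𝕜 : Type*} {L : Type*} [Field 𝕜] [AddCommGroup L] [Module 𝕜 L]

/-- Homogeneous elements of a DG Lie algebra. -/
def IsHomogeneous (G : DGLieAlgebra 𝕜 L) (a : L) : Prop :=
  ∃ i : ℤ, a ∈ G.gr i

/-- Homogeneous elements of odd degree in `L`, that is, of even degree in `L[1]`. They can be moved
past any other argument of the Taylor coefficients of an `L∞`-derivation without a sign. -/
def IsShiftedEven (G : DGLieAlgebra 𝕜 L) (a : L) : Prop :=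
  ∃ i : ℤ, Odd i ∧ a ∈ G.gr i

variable {G : DGLieAlgebra 𝕜 L}

theorem IsShiftedEven.isHomogeneous {a : L} (h : G.IsShiftedEven a) : G.IsHomogeneous a :=
  let ⟨i, _, hi⟩ := h
  ⟨i, hi⟩

theorem D₂_of_odd {i : ℤ} (hi : Odd i) (a b : L) :
    G.D₂ i a b = G.br a b := by
  rw [DGLieAlgebra.D₂, Int.negOnePow_even _ (hi.sub_odd odd_one), one_smul]

end DGLieAlgebra

section Signs

variable {n : ℕ} {deg : Fin (n + 1) → ℤ}

theorem koszulOne_zero : koszulOne deg 0 = 1 := by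
  have h : Finset.Iio (0 : Fin (n + 1)) = ∅ := by ext k; simp
  simp [koszulOne, h]

theorem koszulOp_zero : koszulOp deg 0 = 1 := by
  have h : Finset.Iio (0 : Fin (n + 1)) = ∅ := by ext k; simp
  simp [koszulOp, h]

theorem koszulOne_eq_one (hdeg : ∀ i, i ≠ 0 → Odd (deg i)) (i : Fin (n + 1)) :
    koszulOne deg i = 1 := by
  rcases eq_or_ne i 0 with rfl | hi
  · exact koszulOne_zero
  · exact Int.negOnePow_even _ (((hdeg i hi).sub_odd odd_one).mul_right _)

theorem koszulOp_of_ne_zero (hdeg : ∀ i, i ≠ 0 → Odd (deg i)) {i : Fin (n + 1)} (hi : i ≠ 0) :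
    koszulOp deg i = (deg 0 - 1).negOnePow := by
  rw [koszulOp, ← Finset.add_sum_erase (Finset.Iio i) _ (Finset.mem_Iio.2 (Fin.pos_of_ne_zero hi)),
    Int.negOnePow_add, Int.negOnePow_even (∑ k ∈ _, _), mul_one]
  exact Finset.even_sum _ fun k hk => (hdeg k (Finset.ne_of_mem_erase hk)).sub_odd odd_one

theorem koszulTwo_eq_one (hdeg : ∀ i, i ≠ 0 → Odd (deg i)) {i j : Fin (n + 1)} (hij : i < j) :
    koszulTwo deg i j = 1 := by
  have hj : Even (deg j - 1) := (hdeg j (Fin.ne_zero_of_lt hij)).sub_odd odd_one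
  rw [koszulTwo, Int.negOnePow_add, Int.negOnePow_even _ (hj.mul_right _), mul_one]
  exact koszulOne_eq_one hdeg i

end Signs

namespace LInftyDerivation

variable {𝕜 : Type*} {L : Type*} [Field 𝕜] [AddCommGroup L] [Module 𝕜 L]
  {G : DGLieAlgebra 𝕜 L}

/-- The Taylor coefficients of an `L∞`-derivation evaluated on the entries of a list. -/
def onList (𝒳 : LInftyDerivation G) (l : List L) : L :=
  𝒳.X l.length l.get

variable (𝒳 : LInftyDerivation G)

theorem onList_eq {l : List L} {n : ℕ} (a : Fin n → L) (hl : l.length = n)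
    (h : ∀ i : Fin n, l[(i : ℕ)]'(by rw [hl]; exact i.2) = a i) : 𝒳.onList l = 𝒳.X n a := by
  subst hl
  rw [onList]
  congr 1
  funext i
  exact h i

theorem onList_ofFn {n : ℕ} (a : Fin n → L) : 𝒳.onList (List.ofFn a) = 𝒳.X n a :=
  𝒳.onList_eq a (by simp) (by simp)

theorem onList_nil : 𝒳.onList [] = 0 := by
  change 𝒳.X 0 _ = 0
  rw [𝒳.X_zero]
  rfl

theorem onList_cons_eq (z : L) (l : List L) :
    𝒳.onList (z :: l) = 𝒳.X (l.length + 1) (Fin.cons z l.get) := by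
  rw [← onList_ofFn, List.ofFn_succ]
  simp

theorem onList_cons_add (z z' : L) (l : List L) :
    𝒳.onList ((z + z') :: l) = 𝒳.onList (z :: l) + 𝒳.onList (z' :: l) := by
  simp only [onList_cons_eq]
  exact (𝒳.X (l.length + 1)).cons_add l.get z z'

theorem onList_cons_smul (c : 𝕜) (z : L) (l : List L) :
    𝒳.onList ((c • z) :: l) = c • 𝒳.onList (z :: l) := by
  simp only [onList_cons_eq]
  exact (𝒳.X (l.length + 1)).cons_smul l.get c z

theorem onList_cons_negOnePow_smul (m : ℤ) (z : L) (l : List L) :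
    𝒳.onList ((m.negOnePow • z) :: l) = m.negOnePow • 𝒳.onList (z :: l) := by
  have h : ∀ y : L, m.negOnePow • y = ((m.negOnePow : ℤ) : 𝕜) • y := fun y => by
    rw [Units.smul_def, Int.cast_smul_eq_zsmul]
  rw [h, h, onList_cons_smul]

/-- Graded symmetry of the Taylor coefficients for two neighbouring entries. -/
theorem onList_swap {c l : List L} {x y : L} {i j : ℤ} (hx : x ∈ G.gr i) (hy : y ∈ G.gr j)
    (hc : ∀ z ∈ c, G.IsHomogeneous z) (hl : ∀ z ∈ l, G.IsHomogeneous z) :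
    𝒳.onList (c ++ y :: x :: l) =
      ((i - 1) * (j - 1)).negOnePow • 𝒳.onList (c ++ x :: y :: l) := by
  set u := c ++ x :: y :: l with hu
  have hlen : u.length = c.length + l.length + 2 := by simp [hu]; omega
  have hhom : ∀ z ∈ u, G.IsHomogeneous z := by
    intro z hz
    simp only [hu, List.mem_append, List.mem_cons] at hz
    rcases hz with hz | rfl | rfl | hz
    exacts [hc z hz, ⟨i, hx⟩, ⟨j, hy⟩, hl z hz]
  choose deg hdeg using fun k : Fin u.length => hhom _ (List.getElem_mem k.2)
  have hp : c.length < u.length := by omega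
  have hq : c.length + 1 < u.length := by omega
  have h := 𝒳.X_symm u.length
    (Function.update (Function.update deg ⟨_, hp⟩ i) ⟨_, hq⟩ j) u.get (by
      intro k
      by_cases h1 : k = ⟨_, hq⟩
      · subst h1
        simpa [hu, List.getElem_append] using hy
      by_cases h2 : k = ⟨_, hp⟩
      · subst h2
        simpa [hu, List.getElem_append] using hx
      simpa [Function.update_of_ne, h1, h2] using hdeg k) ⟨_, hp⟩ ⟨_, hq⟩ rfl
  simp only [Function.update_self, Function.update_of_ne
    (show (⟨c.length, hp⟩ : Fin u.length) ≠ ⟨c.length + 1, hq⟩ by simp)] at h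
  change _ = _ • 𝒳.X _ u.get
  rw [← h]
  refine 𝒳.onList_eq _ (by simp [hu]) fun k => ?_
  simp only [Function.comp, Equiv.swap_apply_def, Fin.ext_iff, List.get_eq_getElem, hu]
  grind

/-- A shifted-even argument `e` passes the entry `z` without a sign. -/
theorem onList_swap_even {c l : List L} {e z : L} (he : G.IsShiftedEven e)
    (hz : G.IsHomogeneous z) (hc : ∀ z ∈ c, G.IsHomogeneous z)
    (hl : ∀ z ∈ l, G.IsHomogeneous z) :
    𝒳.onList (c ++ e :: z :: l) = 𝒳.onList (c ++ z :: e :: l) := by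
  obtain ⟨i, hi, he⟩ := he
  obtain ⟨j, hz⟩ := hz
  rw [𝒳.onList_swap hz he hc hl, Int.negOnePow_even _ ((hi.sub_odd odd_one).mul_left _), one_smul]

/-- An entry replacing `v i` can be moved in front of the shifted-even entries `v`. The prefix `c` is
there for the induction, which moves entries of `v` into it. -/
theorem onList_update {n : ℕ} (v : Fin (n + 1) → L) (hv : ∀ i, G.IsShiftedEven (v i))
    (i : Fin (n + 1)) {z : L} (hz : G.IsHomogeneous z) {c : List L}
    (hc : ∀ z ∈ c, G.IsHomogeneous z) :
    𝒳.onList (c ++ List.ofFn (Function.update v i z)) =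
      𝒳.onList (c ++ z :: List.ofFn (i.removeNth v)) := by
  induction n generalizing c with
  | zero =>
    obtain rfl : i = 0 := Fin.fin_one_eq_zero i
    rw [List.ofFn_succ]
    simp
  | succ n ih =>
    refine Fin.cases ?_ (fun i => ?_) i
    · rw [List.ofFn_succ, ofFn_removeNth_zero]
      simp
    · have hu : (fun k : Fin (n + 1) => Function.update v i.succ z k.succ) =
          Function.update (fun k => v k.succ) i z := by
        funext k
        simp [Function.update_apply]
      rw [List.ofFn_succ, hu, Function.update_of_ne (Fin.succ_ne_zero i).symm, List.append_cons,
        ih _ (fun k => hv k.succ) i, ofFn_removeNth_succ, ← List.append_cons,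
        𝒳.onList_swap_even (hv 0) hz hc]
      · intro y hy
        obtain ⟨k, rfl⟩ := List.mem_ofFn.1 hy
        exact (hv _).isHomogeneous
      · intro y hy
        rcases List.mem_append.1 hy with hy | hy
        · exact hc y hy
        · rw [List.mem_singleton.1 hy]
          exact (hv 0).isHomogeneous

end LInftyDerivation

/-! ### The equation of an `L∞`-derivation for lists of arguments -/

namespace LInftyDerivation

variable {𝕜 : Type*} {L : Type*} [Field 𝕜] [AddCommGroup L] [Module 𝕜 L]
  {G : DGLieAlgebra 𝕜 L} (𝒳 : LInftyDerivation G)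

theorem isHomogeneous_of_mem_ofFn {n : ℕ} {v : Fin n → L} (hv : ∀ i, G.IsShiftedEven (v i)) :
    ∀ z ∈ List.ofFn v, G.IsHomogeneous z := by
  intro z hz
  obtain ⟨k, rfl⟩ := List.mem_ofFn.1 hz
  exact (hv k).isHomogeneous

/-- Moving `D` to `v i` and then `D (v i)` to the front gives the same sign twice, as `D (v i)` has
odd degree in `L[1]` and thus passes `w` with the sign of an operator of degree `1`. -/
theorem koszulOp_smul_X_update {n : ℕ} {w : L} {j : ℤ} (hw : w ∈ G.gr j) {v : Fin (n + 1) → L}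
    {e : Fin (n + 1) → ℤ} (he : ∀ i, Odd (e i)) (hv : ∀ i, v i ∈ G.gr (e i)) (i : Fin (n + 1)) :
    koszulOp (Fin.cons j e : Fin (n + 2) → ℤ) i.succ •
      𝒳.X (n + 2) (Function.update (Fin.cons w v : Fin (n + 2) → L) i.succ (G.d (v i))) =
      𝒳.onList (G.d (v i) :: w :: List.ofFn (i.removeNth v)) := by
  have hve : ∀ i, G.IsShiftedEven (v i) := fun i => ⟨e i, he i, hv i⟩
  have hd : G.d (v i) ∈ G.gr (e i + 1) := G.d_mem (hv i)
  rw [koszulOp_of_ne_zero (Fin.cases (fun h => (h rfl).elim) fun i _ => by simpa using he i)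
    (Fin.succ_ne_zero i), ← onList_ofFn, ← Fin.cons_update, List.ofFn_cons]
  have h := 𝒳.onList_update v hve i ⟨_, hd⟩ (c := [w]) (by simpa using ⟨j, hw⟩)
  have h' := 𝒳.onList_swap (c := []) (l := List.ofFn (i.removeNth v)) hd hw (by simp)
    (isHomogeneous_of_mem_ofFn fun k => hve _)
  have hs : ((e i + 1 - 1) * (j - 1)).negOnePow = (j - 1).negOnePow := by
    rw [Int.negOnePow_eq_iff]
    have : (e i + 1 - 1) * (j - 1) - (j - 1) = (e i - 1) * (j - 1) := by ring
    rw [this]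
    exact ((he i).sub_odd odd_one).mul_right _
  simp only [List.nil_append, List.singleton_append] at h h'
  rw [h, h', hs, Fin.cons_zero, Int.negOnePow_smul_self]

/-- The equation `D ∘ 𝒳 = 𝒳 ∘ D` for arguments which, except for the first one, have even degree in
`L[1]`: apart from the sign `(-1)^(j - 1)` for moving an operator of degree `1` past `w`, all Koszul
signs are trivial. -/
theorem comm_list {w : L} {j : ℤ} (hw : w ∈ G.gr j) {l : List L}
    (hl : ∀ y ∈ l, G.IsShiftedEven y) :
    G.d (𝒳.onList (w :: l)) + (j - 1).negOnePow • G.br w (𝒳.onList l)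
        + pickSum (fun y r => G.br y (𝒳.onList (w :: r))) l =
      𝒳.onList (G.d w :: l) + pickSum (fun y r => 𝒳.onList (G.d y :: w :: r)) l
        + (j - 1).negOnePow • pickSum (fun y r => 𝒳.onList (G.br w y :: r)) l
        + pairSum (fun u v r => 𝒳.onList (G.br u v :: w :: r)) l := by
  rcases l with _ | ⟨x, l⟩
  -- With a single argument, all terms except those with `d` are zero, also because `X₀ = 0`.
  · have h := 𝒳.comm_one w
    rw [← onList_ofFn, ← onList_ofFn] at h
    simp only [List.ofFn_succ, List.ofFn_zero, Matrix.cons_val_zero] at h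
    simp [pickSum, pairSum, onList_nil, h]
  obtain ⟨n, v, hv⟩ : ∃ (n : ℕ) (v : Fin (n + 1) → L), x :: l = List.ofFn v :=
    ⟨l.length, (x :: l).get, (List.ofFn_get _).symm⟩
  rw [hv] at hl ⊢
  choose e he hve using fun i => hl (v i) (List.mem_ofFn.2 ⟨i, rfl⟩)
  have hdeg : ∀ i : Fin (n + 2), i ≠ 0 → Odd ((Fin.cons j e : Fin (n + 2) → ℤ) i) :=
    Fin.cases (fun h => (h rfl).elim) fun i _ => by simpa using he i
  have h := 𝒳.comm n (Fin.cons j e) (Fin.cons w v)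
    (Fin.cases (by simpa using hw) fun i => by simpa using hve i)
  rw [← onList_ofFn, List.ofFn_cons] at h
  have h1 : ∑ i : Fin (n + 2), koszulOne (Fin.cons j e : Fin (n + 2) → ℤ) i •
      G.D₂ ((Fin.cons j e : Fin (n + 2) → ℤ) i) ((Fin.cons w v : Fin (n + 2) → L) i)
        (𝒳.X (n + 1) (i.removeNth (Fin.cons w v : Fin (n + 2) → L))) =
      (j - 1).negOnePow • G.br w (𝒳.onList (List.ofFn v))
        + pickSum (fun y r => G.br y (𝒳.onList (w :: r))) (List.ofFn v) := by
    rw [← sum_removeNth_eq_pickSum, Fin.sum_univ_succ]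
    simp only [koszulOne_eq_one hdeg, one_smul, Fin.cons_zero, Fin.cons_succ,
      DGLieAlgebra.D₂_of_odd (he _), ← onList_ofFn, ofFn_removeNth_succ, ofFn_removeNth_zero]
    rfl
  have h2 : ∑ i : Fin (n + 2), koszulOp (Fin.cons j e : Fin (n + 2) → ℤ) i •
      𝒳.X (n + 2) (Function.update (Fin.cons w v : Fin (n + 2) → L) i
        (G.d ((Fin.cons w v : Fin (n + 2) → L) i))) =
      𝒳.onList (G.d w :: List.ofFn v)
        + pickSum (fun y r => 𝒳.onList (G.d y :: w :: r)) (List.ofFn v) := by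
    rw [← sum_removeNth_eq_pickSum, Fin.sum_univ_succ]
    simp only [Fin.cons_succ, 𝒳.koszulOp_smul_X_update hw he hve]
    rw [koszulOp_zero, one_smul, Fin.cons_zero, Fin.update_cons_zero, ← onList_ofFn,
      List.ofFn_cons]
  have h3 : (∑ b : Fin (n + 2), ∑ a : Fin (n + 1), if a.castSucc < b then
      koszulTwo (Fin.cons j e : Fin (n + 2) → ℤ) a.castSucc b •
        𝒳.X (n + 1) (Fin.cons (G.D₂ ((Fin.cons j e : Fin (n + 2) → ℤ) a.castSucc)
          ((Fin.cons w v : Fin (n + 2) → L) a.castSucc) ((Fin.cons w v : Fin (n + 2) → L) b))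
            (a.removeNth (b.removeNth (Fin.cons w v : Fin (n + 2) → L)))) else 0) =
      (j - 1).negOnePow • pickSum (fun y r => 𝒳.onList (G.br w y :: r)) (List.ofFn v)
        + pairSum (fun u v r => 𝒳.onList (G.br u v :: w :: r)) (List.ofFn v) := by
    have hk : ∀ (b : Fin (n + 2)) (a : Fin (n + 1)) (z : L), (if a.castSucc < b then
        koszulTwo (Fin.cons j e : Fin (n + 2) → ℤ) a.castSucc b • z else 0) =
          if a.castSucc < b then z else 0 := by
      intro b a z
      split_ifs with hab
      · rw [koszulTwo_eq_one hdeg hab, one_smul]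
      · rfl
    simp only [hk]
    rw [sum_pairs_succ, ← sum_removeNth_eq_pickSum, Finset.smul_sum]
    congr 1
    · refine Finset.sum_congr rfl fun b _ => ?_
      have hr : List.ofFn ((0 : Fin (n + 1)).removeNth
          (b.succ.removeNth (Fin.cons w v : Fin (n + 2) → L))) = List.ofFn (b.removeNth v) := by
        rw [ofFn_removeNth_zero]
        congr 1
        funext k
        simp [Fin.removeNth]
      rw [← onList_ofFn, List.ofFn_cons, hr, Fin.castSucc_zero, Fin.cons_zero, Fin.cons_zero,
        Fin.cons_succ, DGLieAlgebra.D₂, onList_cons_negOnePow_smul]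
    · rcases n with _ | n
      · simp [List.ofFn_succ, pairSum, pickSum]
      rw [← sum_removeNth_eq_pairSum]
      refine Finset.sum_congr rfl fun b _ => Finset.sum_congr rfl fun a _ => ?_
      have hr : List.ofFn (a.succ.removeNth
          (b.succ.removeNth (Fin.cons w v : Fin (n + 3) → L))) =
            w :: List.ofFn (a.removeNth (b.removeNth v)) := by
        rw [ofFn_removeNth_succ]
        congr 2
        funext k
        simp [Fin.removeNth]
      rw [← onList_ofFn, List.ofFn_cons, hr, ← Fin.succ_castSucc, Fin.cons_succ, Fin.cons_succ,
        Fin.cons_succ, DGLieAlgebra.D₂_of_odd (he _)]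
  rw [h1, h2, h3] at h
  rw [← add_assoc, ← add_assoc] at h
  exact h

end LInftyDerivation

/-! ### Series with repeated arguments -/

section ConditionalSums

open Filter Topology SummationFilter

variable {M : Type*} [AddCommGroup M] [TopologicalSpace M]

theorem hasSum_conditional_iff_tendsto_range {f : ℕ → M} {a : M} :
    HasSum f a (conditional ℕ) ↔ Tendsto (fun n => ∑ i ∈ Finset.range n, f i) atTop (𝓝 a) := by
  rw [HasSum, conditional_filter_eq_map_range, tendsto_map'_iff]
  rfl

theorem hasSum_conditional_succ_iff {f : ℕ → M} (h : f 0 = 0) {a : M} :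
    HasSum (fun n => f (n + 1)) a (conditional ℕ) ↔ HasSum f a (conditional ℕ) := by
  rw [hasSum_conditional_iff_tendsto_range, hasSum_conditional_iff_tendsto_range,
    ← tendsto_add_atTop_iff_nat (f := fun n => ∑ i ∈ Finset.range n, f i) 1]
  simp only [Finset.sum_range_succ', h, add_zero]

theorem mem_of_hasSum_conditional {S : Type*} [SetLike S M] [AddSubmonoidClass S M] {s : S}
    (hs : IsClosed (s : Set M)) {f : ℕ → M} {a : M} (h : HasSum f a (conditional ℕ))
    (hf : ∀ n, f n ∈ s) : a ∈ s :=
  hs.mem_of_tendsto (hasSum_conditional_iff_tendsto_range.1 h)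
    (Eventually.of_forall fun _ => sum_mem fun i _ => hf i)

variable [IsTopologicalAddGroup M] {F : SummationFilter ℕ}

theorem HasSum.units_smul {f : ℕ → M} {a : M} (h : HasSum f a F) (u : ℤˣ) :
    HasSum (fun n => u • f n) (u • a) F := by
  rcases Int.units_eq_one_or u with rfl | rfl
  · simpa using h
  · simpa [Units.neg_smul] using h.neg

theorem HasSum.pickSum {α : Type*} {f : ℕ → α → List α → M} {f' : α → List α → M} {l : List α}
    (h : ∀ y ∈ l, ∀ r, HasSum (fun n => f n y r) (f' y r) F) :
    HasSum (fun n => pickSum (f n) l) (pickSum f' l) F := by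
  induction l generalizing f f' with
  | nil => exact hasSum_zero
  | cons x l ih => exact (h x (by simp) l).add (ih fun y hy r => h y (by simp [hy]) _)

theorem HasSum.pairSum {α : Type*} {f : ℕ → α → α → List α → M} {f' : α → α → List α → M}
    {l : List α} (h : ∀ u v r, HasSum (fun n => f n u v r) (f' u v r) F) :
    HasSum (fun n => pairSum (f n) l) (pairSum f' l) F := by
  induction l generalizing f f' with
  | nil => exact hasSum_zero
  | cons x l ih => exact (HasSum.pickSum fun y _ r => h x y r).add (ih fun u v r => h u v _)

end ConditionalSums

section Factorials

variable {𝕜 M : Type*} [Field 𝕜] [CharZero 𝕜] [AddCommGroup M] [Module 𝕜 M]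

theorem inv_factorial_succ_smul_nsmul (p : ℕ) (z : M) :
    (((p + 1).factorial : 𝕜)⁻¹) • (p + 1) • z = ((p.factorial : 𝕜)⁻¹) • z := by
  rw [← Nat.cast_smul_eq_nsmul 𝕜, smul_smul]
  congr 1
  have h1 : (p.factorial : 𝕜) ≠ 0 := Nat.cast_ne_zero.2 p.factorial_ne_zero
  have h2 : ((p + 1 : ℕ) : 𝕜) ≠ 0 := Nat.cast_ne_zero.2 p.succ_ne_zero
  rw [Nat.factorial_succ, Nat.cast_mul]
  field_simp

theorem inv_factorial_add_two_smul_choose (p : ℕ) (z : M) :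
    (((p + 2).factorial : 𝕜)⁻¹) • (p + 2).choose 2 • (2 : 𝕜) • z = ((p.factorial : 𝕜)⁻¹) • z := by
  rw [← Nat.cast_smul_eq_nsmul 𝕜, smul_smul, smul_smul]
  congr 1
  have h1 : (p.factorial : 𝕜) ≠ 0 := Nat.cast_ne_zero.2 p.factorial_ne_zero
  have h2 : (((p + 2).choose 2 : ℕ) : 𝕜) ≠ 0 :=
    Nat.cast_ne_zero.2 (Nat.choose_pos (by omega)).ne'
  have h3 := Nat.choose_mul_factorial_mul_factorial (n := p + 2) (k := 2) (by omega)
  rw [Nat.add_sub_cancel, Nat.factorial_two] at h3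
  rw [← h3]
  push_cast
  field_simp

end Factorials

theorem DGLieAlgebra.IsMaurerCartan.br_self {𝕜 : Type*} {L : Type*} [Field 𝕜] [CharZero 𝕜]
    [AddCommGroup L] [Module 𝕜 L] {G : DGLieAlgebra 𝕜 L} {π : L} (hπ : G.IsMaurerCartan π) :
    G.br π π = (2 : 𝕜) • -G.d π := by
  have h := hπ.2
  rw [neg_eq_of_add_eq_zero_right h, smul_smul, mul_inv_cancel₀ two_ne_zero, one_smul]

namespace LInftyDerivation

open SummationFilter

variable {𝕜 : Type*} {L : Type*} [Field 𝕜] [AddCommGroup L] [Module 𝕜 L]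
  {G : DGLieAlgebra 𝕜 L} (𝒳 : LInftyDerivation G) (π : L)

/-- The terms of the series defining `𝒳_{π,n}(a₁, …, aₙ)`, for arguments given as a list. For the
empty list these are the terms of `𝒳(π)`. -/
noncomputable def listTerm (l : List L) (p : ℕ) : L :=
  ((p.factorial : 𝕜)⁻¹) • 𝒳.onList (l ++ List.replicate p π)

theorem twistTerm_eq_listTerm {n : ℕ} (a : Fin n → L) :
    𝒳.twistTerm π n a = 𝒳.listTerm π (List.ofFn a) := by
  funext p
  rw [twistTerm, listTerm, ← onList_ofFn, List.ofFn_fin_append, List.ofFn_const]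

theorem valueTerm_eq_listTerm : 𝒳.valueTerm π = 𝒳.listTerm π [] := by
  funext p
  rw [valueTerm, listTerm, ← onList_ofFn, List.ofFn_const, List.nil_append]

theorem listTerm_cons_add (a c : L) (l : List L) (p : ℕ) :
    𝒳.listTerm π ((a + c) :: l) p = 𝒳.listTerm π (a :: l) p + 𝒳.listTerm π (c :: l) p := by
  simp only [listTerm, List.cons_append, onList_cons_add, smul_add]

theorem listTerm_cons_negOnePow_smul (m : ℤ) (a : L) (l : List L) (p : ℕ) :
    𝒳.listTerm π ((m.negOnePow • a) :: l) p = m.negOnePow • 𝒳.listTerm π (a :: l) p := by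
  rw [listTerm, listTerm, List.cons_append, List.cons_append, onList_cons_negOnePow_smul,
    smul_comm]

variable [TopologicalSpace L]

/-- `𝒳_{π,n}(a₁, …, aₙ)` for arguments given as a list; for the empty list this is `𝒳(π)`. -/
noncomputable def twistList (l : List L) : L :=
  ∑'[conditional ℕ] p, 𝒳.listTerm π l p

theorem twist_eq_twistList {n : ℕ} (a : Fin n → L) :
    𝒳.twist π n a = 𝒳.twistList π (List.ofFn a) := by
  rw [twist, twistTerm_eq_listTerm, twistList]

theorem eval_eq_twistList : 𝒳.eval π = 𝒳.twistList π [] := by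
  rw [eval, valueTerm_eq_listTerm, twistList]

theorem twistOne_eq_twistList (a : L) : 𝒳.twistOne π a = 𝒳.twistList π [a] := by
  rw [twistOne, twist_eq_twistList]
  rfl

variable {𝒳 π}

theorem IsStrongNijenhuis.twistList_eq_zero (hN : 𝒳.IsStrongNijenhuis π) {l : List L}
    (h : 𝒳.eval π ∈ l) : 𝒳.twistList π l = 0 := by
  obtain ⟨i, hi⟩ := List.get_of_mem h
  rw [← List.ofFn_get l, ← twist_eq_twistList]
  exact hN _ _ ⟨i, hi⟩

theorem Converges.hasSum (hconv : 𝒳.Converges π) (l : List L) :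
    HasSum (𝒳.listTerm π l) (𝒳.twistList π l) (conditional ℕ) := by
  rcases l with _ | ⟨x, l⟩
  · rw [← valueTerm_eq_listTerm, ← eval_eq_twistList]
    exact hconv.eval.hasSum
  · have h := (hconv.twist (l.length + 1) (by omega) (x :: l).get).hasSum
    rw [twistTerm_eq_listTerm, List.ofFn_get] at h
    exact h

theorem Converges.hasSum_d (hG : G.IsTopological) (hconv : 𝒳.Converges π) (l : List L) :
    HasSum (fun p => G.d (𝒳.listTerm π l p)) (G.d (𝒳.twistList π l)) (conditional ℕ) :=
  (hconv.hasSum l).map G.d hG.continuous_d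

theorem Converges.hasSum_br (hG : G.IsTopological) (hconv : 𝒳.Converges π) (a : L) (l : List L) :
    HasSum (fun p => G.br a (𝒳.listTerm π l p)) (G.br a (𝒳.twistList π l)) (conditional ℕ) :=
  (hconv.hasSum l).map (G.br a) (hG.continuous_br a)

/-- The contribution of the terms in which an operation is applied to one of the arguments `π` of
`Xₙ₊ₚ(a₁, …, aₙ, π, …, π)`. For `p = 0` the truncated `p - 1` does not matter because of the
factor `p`. -/
theorem Converges.hasSum_pick [CharZero 𝕜] (hconv : 𝒳.Converges π) (l : List L) :
    HasSum (fun p => ((p.factorial : 𝕜)⁻¹) • p • 𝒳.onList (l ++ List.replicate (p - 1) π))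
      (𝒳.twistList π l) (conditional ℕ) := by
  refine (hasSum_conditional_succ_iff (by simp)).1 ?_
  simp only [inv_factorial_succ_smul_nsmul, Nat.add_sub_cancel]
  exact hconv.hasSum l

/-- The contribution of the terms in which the bracket is applied to two of the arguments `π`; by
the Maurer-Cartan equation it is opposite to that of the terms containing `dπ`. The factor `2` in `[π, π] = -2 dπ` is used term by
term, since scalar multiplication is not assumed to be continuous. -/
theorem Converges.hasSum_pair [CharZero 𝕜] [IsTopologicalAddGroup L]
    (hconv : 𝒳.Converges π) (hπ : G.IsMaurerCartan π) (l : List L) :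
    HasSum (fun p => ((p.factorial : 𝕜)⁻¹) • p.choose 2 •
      𝒳.onList (G.br π π :: (l ++ List.replicate (p - 2) π)))
      (-𝒳.twistList π (G.d π :: l)) (conditional ℕ) := by
  refine (hasSum_conditional_succ_iff (by simp)).1 ((hasSum_conditional_succ_iff ?_).1 ?_)
  · simp
  simp only [hπ.br_self, onList_cons_smul, add_assoc, Nat.reduceAdd,
    inv_factorial_add_two_smul_choose, Nat.add_sub_cancel]
  have hneg : ∀ r, 𝒳.onList (-G.d π :: r) = -𝒳.onList (G.d π :: r) := fun r => by
    rw [← neg_one_smul 𝕜, onList_cons_smul, neg_one_smul]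
  simp only [hneg, smul_neg]
  exact (hconv.hasSum (G.d π :: l)).neg

theorem twistList_mem (hG : G.IsTopological) (hπ : π ∈ G.gr 1)
    (hconv : 𝒳.Converges π) {n : ℕ} {a : Fin n → L} {e : Fin n → ℤ}
    (ha : ∀ i, a i ∈ G.gr (e i)) :
    𝒳.twistList π (List.ofFn a) ∈ G.gr ((∑ i, e i) + 1 - n) := by
  refine mem_of_hasSum_conditional (hG.isClosed_gr _) (hconv.hasSum _) fun p => ?_
  rw [← twistTerm_eq_listTerm]
  refine Submodule.smul_mem _ _ ?_
  have h := 𝒳.X_mem (n + p) (Fin.append e fun _ => 1) (Fin.append a fun _ => π)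
    (Fin.addCases (fun i => by simpa using ha i) fun i => by simpa using hπ)
  rw [Fin.sum_univ_add] at h
  simp only [Fin.append_left, Fin.append_right, Finset.sum_const, Finset.card_univ,
    Fintype.card_fin, nsmul_eq_mul, mul_one] at h
  convert h using 2
  push_cast
  ring

variable [T2Space L] [IsTopologicalAddGroup L]

theorem Converges.twistList_cons_add (hconv : 𝒳.Converges π) (a c : L) (l : List L) :
    𝒳.twistList π ((a + c) :: l) = 𝒳.twistList π (a :: l) + 𝒳.twistList π (c :: l) := by
  have h := (hconv.hasSum (a :: l)).add (hconv.hasSum (c :: l))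
  simp only [← listTerm_cons_add] at h
  exact (hconv.hasSum _).unique h

theorem Converges.twistList_cons_negOnePow_smul (hconv : 𝒳.Converges π) (m : ℤ) (a : L)
    (l : List L) :
    𝒳.twistList π ((m.negOnePow • a) :: l) = m.negOnePow • 𝒳.twistList π (a :: l) := by
  have h := (hconv.hasSum (a :: l)).units_smul m.negOnePow
  simp only [← listTerm_cons_negOnePow_smul] at h
  exact (hconv.hasSum _).unique h

theorem Converges.twistList_cons_zero (hconv : 𝒳.Converges π) (l : List L) :
    𝒳.twistList π (0 :: l) = 0 := by
  have h := hconv.twistList_cons_add 0 0 l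
  rwa [add_zero, left_eq_add] at h

end LInftyDerivation

/-! ### The twisted equation -/

namespace DGLieAlgebra

variable {𝕜 : Type*} {L : Type*} [Field 𝕜] [AddCommGroup L] [Module 𝕜 L]
  {G : DGLieAlgebra 𝕜 L}

theorem br_comm_of_odd {π y : L} {i j : ℤ} (hy : y ∈ G.gr i) (hπ : π ∈ G.gr j) (hj : Odd j) :
    G.br y π = (i - 1).negOnePow • G.br π y := by
  have h : (i * j).negOnePow = i.negOnePow := by
    rw [Int.negOnePow_eq_iff]
    have : i * j - i = i * (j - 1) := by ring
    rw [this]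
    exact (hj.sub_odd odd_one).mul_left _
  rw [G.br_skew hy hπ, h, Int.negOnePow_sub, Int.negOnePow_one, mul_neg_one, Units.neg_smul]

end DGLieAlgebra

namespace LInftyDerivation

open SummationFilter

variable {𝕜 : Type*} {L : Type*} [Field 𝕜] [CharZero 𝕜] [AddCommGroup L] [Module 𝕜 L]
  [TopologicalSpace L] [IsTopologicalAddGroup L]
  {G : DGLieAlgebra 𝕜 L} {𝒳 : LInftyDerivation G} {π : L}

/-- The left hand side of `comm_list` for the arguments `w, b, π, …, π`, summed over the number of
arguments `π`. -/
theorem hasSum_comm_list_left (hG : G.IsTopological) (hconv : 𝒳.Converges π) (w : L) (j : ℤ)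
    (b : List L) :
    HasSum (fun p => ((p.factorial : 𝕜)⁻¹) • (G.d (𝒳.onList (w :: (b ++ List.replicate p π)))
        + (j - 1).negOnePow • G.br w (𝒳.onList (b ++ List.replicate p π))
        + pickSum (fun y r => G.br y (𝒳.onList (w :: r))) (b ++ List.replicate p π)))
      (G.d (𝒳.twistList π (w :: b)) + (j - 1).negOnePow • G.br w (𝒳.twistList π b)
        + (pickSum (fun y r => G.br y (𝒳.twistList π (w :: r))) b
          + G.br π (𝒳.twistList π (w :: b)))) (conditional ℕ) := by
  have h := ((hconv.hasSum_d hG (w :: b)).add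
    ((hconv.hasSum_br hG w b).units_smul (j - 1).negOnePow)).add
    ((HasSum.pickSum (l := b) fun y _ r => hconv.hasSum_br hG y (w :: r)).add
      ((hconv.hasSum_pick (w :: b)).map (G.br π) (hG.continuous_br π)))
  convert h using 1
  funext p
  simp only [smul_add, smul_pickSum, pickSum_append, pickSum_replicate, listTerm, map_smul,
    map_nsmul, Function.comp_apply, List.cons_append, smul_comm _ (j - 1).negOnePow]

/-- The right hand side of `comm_list` for the arguments `w, b, π, …, π`, summed over the number of
arguments `π`. -/
theorem hasSum_comm_list_right (hconv : 𝒳.Converges π) (hπ : G.IsMaurerCartan π) (w : L) (j : ℤ)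
    (b : List L) :
    HasSum (fun p => ((p.factorial : 𝕜)⁻¹) • (𝒳.onList (G.d w :: (b ++ List.replicate p π))
        + pickSum (fun y r => 𝒳.onList (G.d y :: w :: r)) (b ++ List.replicate p π)
        + (j - 1).negOnePow •
          pickSum (fun y r => 𝒳.onList (G.br w y :: r)) (b ++ List.replicate p π)
        + pairSum (fun u v r => 𝒳.onList (G.br u v :: w :: r)) (b ++ List.replicate p π)))
      (𝒳.twistList π (G.d w :: b)
        + (pickSum (fun y r => 𝒳.twistList π (G.d y :: w :: r)) b
          + 𝒳.twistList π (G.d π :: w :: b))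
        + (j - 1).negOnePow • (pickSum (fun y r => 𝒳.twistList π (G.br w y :: r)) b
          + 𝒳.twistList π (G.br w π :: b))
        + (pairSum (fun u v r => 𝒳.twistList π (G.br u v :: w :: r)) b
          + pickSum (fun y r => 𝒳.twistList π (G.br y π :: w :: r)) b
          + -𝒳.twistList π (G.d π :: w :: b))) (conditional ℕ) := by
  have h := (((hconv.hasSum (G.d w :: b)).add
    ((HasSum.pickSum (l := b) fun y _ r => hconv.hasSum (G.d y :: w :: r)).add
      (hconv.hasSum_pick (G.d π :: w :: b)))).add
    (((HasSum.pickSum (l := b) fun y _ r => hconv.hasSum (G.br w y :: r)).add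
      (hconv.hasSum_pick (G.br w π :: b))).units_smul (j - 1).negOnePow)).add
    (((HasSum.pairSum (l := b) fun u v r => hconv.hasSum (G.br u v :: w :: r)).add
      (HasSum.pickSum (l := b) fun y _ r => hconv.hasSum_pick (G.br y π :: w :: r))).add
      (hconv.hasSum_pair hπ (w :: b)))
  convert h using 1
  funext p
  simp only [smul_add, smul_pickSum, smul_pairSum, pickSum_append, pickSum_replicate,
    pairSum_append, pairSum_replicate, listTerm, List.cons_append,
    smul_comm _ (j - 1).negOnePow]

variable [T2Space L]

/-- The equation `D_π ∘ 𝒳_π = 𝒳_π ∘ D_π` for the coderivation `𝒳_π` with Taylor coefficients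
`𝒳(π), 𝒳_{π,1}, 𝒳_{π,2}, …` and the codifferential `D_π` with Taylor coefficients `d_π` and `D₂`,
for arguments which, except for the first one, have even degree in `L[1]`. -/
theorem Converges.comm_twistList (hG : G.IsTopological) (hconv : 𝒳.Converges π)
    (hπ : G.IsMaurerCartan π) {w : L} {j : ℤ} (hw : w ∈ G.gr j) {b : List L}
    (hb : ∀ y ∈ b, G.IsShiftedEven y) :
    G.dTwist π (𝒳.twistList π (w :: b)) + (j - 1).negOnePow • G.br w (𝒳.twistList π b)
        + pickSum (fun y r => G.br y (𝒳.twistList π (w :: r))) b =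
      𝒳.twistList π (G.dTwist π w :: b)
        + pickSum (fun y r => 𝒳.twistList π (G.dTwist π y :: w :: r)) b
        + (j - 1).negOnePow • pickSum (fun y r => 𝒳.twistList π (G.br w y :: r)) b
        + pairSum (fun u v r => 𝒳.twistList π (G.br u v :: w :: r)) b := by
  have h := hasSum_comm_list_left hG hconv w j b
  have heq : ∀ p, _ := fun p => 𝒳.comm_list hw (l := b ++ List.replicate p π) (by
    intro y hy
    rcases List.mem_append.1 hy with hy | hy
    · exact hb y hy
    · rw [List.eq_of_mem_replicate hy]
      exact ⟨1, odd_one, hπ.1⟩)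
  simp only [heq] at h
  have h' := h.unique (hasSum_comm_list_right hconv hπ w j b)
  have h1 : (j - 1).negOnePow • 𝒳.twistList π (G.br w π :: b) = 𝒳.twistList π (G.br π w :: b) := by
    rw [DGLieAlgebra.br_comm_of_odd hw hπ.1 odd_one, hconv.twistList_cons_negOnePow_smul,
      Int.negOnePow_smul_self]
  have h2 : pickSum (fun y r => 𝒳.twistList π (G.br y π :: w :: r)) b =
      pickSum (fun y r => 𝒳.twistList π (G.br π y :: w :: r)) b := by
    refine pickSum_congr fun y hy r _ => ?_
    obtain ⟨i, hi, hyi⟩ := hb y hy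
    rw [DGLieAlgebra.br_comm_of_odd hyi hπ.1 odd_one,
      Int.negOnePow_even _ (hi.sub_odd odd_one), one_smul]
  simp only [DGLieAlgebra.dTwist, hconv.twistList_cons_add, pickSum_add]
  rw [smul_add, h1, h2] at h'
  rw [← sub_eq_zero] at h' ⊢
  rw [← h']
  abel

/-- The component of `D_π ∘ 𝒳_π = 𝒳_π ∘ D_π` without arguments. It is not an instance of
`Converges.comm_twistList`, where the first argument `w` is not one of the summed arguments `π`. -/
theorem Converges.dTwist_eval (hG : G.IsTopological) (hconv : 𝒳.Converges π)
    (hπ : G.IsMaurerCartan π) : G.dTwist π (𝒳.eval π) = 0 := by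
  -- Here `p + 1` arguments are equal to `π`, so the weight is `1/(p + 1)!`.
  have heq : ∀ p, _ := fun p => 𝒳.comm_list hπ.1 (l := List.replicate p π) (by
    intro y hy
    rw [List.eq_of_mem_replicate hy]
    exact ⟨1, odd_one, hπ.1⟩)
  have h0 : 𝒳.listTerm π [] 0 = 0 := by simp [listTerm, onList_nil]
  have hl := ((hasSum_conditional_succ_iff (by rw [h0, map_zero])).2 (hconv.hasSum_d hG [])).add
    (hconv.hasSum_br hG π [])
  have hr := (hconv.hasSum [G.d π]).add
    ((hasSum_conditional_succ_iff (by simp)).2 (hconv.hasSum_pair hπ []))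
  rw [DGLieAlgebra.dTwist, eval_eq_twistList]
  refine (hl.unique ?_).trans (add_neg_cancel (𝒳.twistList π [G.d π]))
  convert hr using 1
  funext p
  have h := heq p
  simp only [sub_self, Int.negOnePow_zero, one_smul, pickSum_replicate, pairSum_replicate] at h
  have h1 : p • 𝒳.onList (G.d π :: π :: List.replicate (p - 1) π) =
      p • 𝒳.onList (G.d π :: List.replicate p π) := by
    cases p <;> simp [List.replicate_succ]
  have h2 : p • G.br π (𝒳.onList (π :: List.replicate (p - 1) π)) =
      p • G.br π (𝒳.onList (List.replicate p π)) := by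
    cases p <;> simp [List.replicate_succ]
  have h3 : p • 𝒳.onList (G.br π π :: List.replicate (p - 1) π)
      + p.choose 2 • 𝒳.onList (G.br π π :: π :: List.replicate (p - 2) π) =
        (p + 1).choose 2 • 𝒳.onList (G.br π π :: List.replicate (p - 1) π) := by
    rw [Nat.choose_succ_succ' p 1, Nat.choose_one_right, add_smul]
    rcases p with _ | _ | p <;> simp [List.replicate_succ]
  rw [h1, h2, add_assoc (_ + _) (p • _), h3, add_assoc (G.d _), ← succ_nsmul',
    ← succ_nsmul'] at h
  have h' := congrArg (fun z => (((p + 1).factorial : 𝕜)⁻¹) • z) h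
  simp only [smul_add, inv_factorial_succ_smul_nsmul] at h'
  simpa [listTerm, List.replicate_succ] using h'

end LInftyDerivation

/-! ### Consequences of the Nijenhuis condition -/

namespace DGLieAlgebra

variable {𝕜 : Type*} {L : Type*} [Field 𝕜] [AddCommGroup L] [Module 𝕜 L]
  {G : DGLieAlgebra 𝕜 L} {π : L}

theorem dTwist_zero : G.dTwist π 0 = 0 := by
  rw [dTwist, map_zero, map_zero, add_zero]

theorem dTwist_eq_br (hG : G.IsDeformation) {a : L} (ha : a ∈ G.gr (-1)) :
    G.dTwist π a = G.br π a := by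
  rw [dTwist, hG.d_eq_zero a ha, zero_add]

theorem br_br_of_odd {a b c : L} {i j : ℤ} (ha : a ∈ G.gr i) (hb : b ∈ G.gr j) (hi : Odd i)
    (hj : Odd j) : G.br a (G.br b c) = G.br (G.br a b) c - G.br b (G.br a c) := by
  rw [G.jacobi c ha hb, Int.negOnePow_odd _ (hi.mul hj), Units.neg_smul, one_smul, sub_eq_add_neg]

theorem dTwist_br_of_odd (hπ : π ∈ G.gr 1) {a b : L} {i : ℤ} (ha : a ∈ G.gr i) (hi : Odd i) :
    G.dTwist π (G.br a b) = G.br (G.dTwist π a) b - G.br a (G.dTwist π b) := by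
  rw [dTwist, dTwist, dTwist, G.leibniz b ha, br_br_of_odd hπ ha odd_one hi,
    Int.negOnePow_odd _ hi, Units.neg_smul, one_smul, map_add, map_add, LinearMap.add_apply]
  abel

theorem br_br_self_eq_zero [CharZero 𝕜] {a b : L} {i : ℤ} (ha : a ∈ G.gr i) (hi : Odd i)
    (h : G.br a a = 0) : G.br a (G.br a b) = 0 := by
  have h' := br_br_of_odd (c := b) ha ha hi hi
  rw [h, map_zero, LinearMap.zero_apply, zero_sub, eq_neg_iff_add_eq_zero, ← two_smul 𝕜] at h'
  exact (smul_eq_zero.1 h').resolve_left two_ne_zero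

theorem IsMaurerCartan.dTwist_dTwist [CharZero 𝕜] (hπ : G.IsMaurerCartan π) (a : L) :
    G.dTwist π (G.dTwist π a) = 0 := by
  have h := br_br_of_odd (c := a) hπ.1 hπ.1 odd_one odd_one
  rw [hπ.br_self, map_smul, map_neg, LinearMap.smul_apply, LinearMap.neg_apply,
    eq_sub_iff_add_eq, ← two_smul 𝕜] at h
  have h' := smul_right_injective L (two_ne_zero (α := 𝕜)) h
  rw [dTwist, dTwist, map_add, map_add, G.d_d, G.leibniz a hπ.1, Int.negOnePow_one,
    Units.neg_smul, one_smul, h']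
  abel

end DGLieAlgebra

namespace LInftyDerivation

variable {𝕜 : Type*} {L : Type*} [Field 𝕜] [AddCommGroup L] [Module 𝕜 L] [TopologicalSpace L]
  {G : DGLieAlgebra 𝕜 L} {𝒳 : LInftyDerivation G} {π : L}

theorem Converges.eval_mem (hG : G.IsTopological) (hconv : 𝒳.Converges π) (hπ : π ∈ G.gr 1) :
    𝒳.eval π ∈ G.gr 1 := by
  have h := twistList_mem hG hπ hconv (a := ![]) (e := ![]) fun i => i.elim0
  rw [eval_eq_twistList]
  simpa using h

theorem Converges.twistOne_mem (hG : G.IsTopological) (hconv : 𝒳.Converges π) (hπ : π ∈ G.gr 1)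
    {a : L} {i : ℤ} (ha : a ∈ G.gr i) : 𝒳.twistOne π a ∈ G.gr i := by
  have h := twistList_mem hG hπ hconv (a := ![a]) (e := ![i])
    fun k => by simpa using ha
  rw [twistOne_eq_twistList]
  simpa using h

/-- `𝒳_{π,2}` lowers the total degree by `1`, so it vanishes on `𝔤⁰ × 𝔤⁻¹`. -/
theorem Converges.twistList_pair_eq_zero (hG : G.IsTopological) (hGd : G.IsDeformation)
    (hconv : 𝒳.Converges π) (hπ : π ∈ G.gr 1) {a b : L} (ha : a ∈ G.gr 0) (hb : b ∈ G.gr (-1)) :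
    𝒳.twistList π [a, b] = 0 := by
  have h := twistList_mem hG hπ hconv (a := ![a, b]) (e := ![0, -1])
    fun k => by fin_cases k <;> simpa
  rw [hGd.gr_eq_bot _ (by simp [Fin.sum_univ_two]), Submodule.mem_bot] at h
  simpa [List.ofFn_succ] using h

theorem twistOne_eval (hN : 𝒳.IsStrongNijenhuis π) : 𝒳.twistOne π (𝒳.eval π) = 0 := by
  rw [twistOne_eq_twistList]
  exact hN.twistList_eq_zero (by simp)

variable [CharZero 𝕜] [IsTopologicalAddGroup L] [T2Space L]

/-- The commutator of `d_π` and `𝒳_{π,1}` is the bracket with `𝒳(π)`. -/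
theorem Converges.twistOne_dTwist (hG : G.IsTopological) (hconv : 𝒳.Converges π)
    (hπ : G.IsMaurerCartan π) {a : L} {i : ℤ} (ha : a ∈ G.gr i) :
    𝒳.twistOne π (G.dTwist π a) = G.dTwist π (𝒳.twistOne π a) + G.br (𝒳.eval π) a := by
  have h := hconv.comm_twistList hG hπ ha (b := []) (by simp)
  rw [← eval_eq_twistList, DGLieAlgebra.br_comm_of_odd ha (hconv.eval_mem hG hπ.1) odd_one,
    Int.negOnePow_smul_self] at h
  simpa [pickSum, pairSum, twistOne_eq_twistList] using h.symm

theorem br_eval_eval (hG : G.IsTopological) (hconv : 𝒳.Converges π) (hπ : G.IsMaurerCartan π)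
    (hN : 𝒳.IsStrongNijenhuis π) : G.br (𝒳.eval π) (𝒳.eval π) = 0 := by
  have h := hconv.twistOne_dTwist hG hπ (hconv.eval_mem hG hπ.1)
  rwa [hconv.dTwist_eval hG hπ, twistOne_eval hN, DGLieAlgebra.dTwist_zero, zero_add,
    twistOne_eq_twistList, hconv.twistList_cons_zero, eq_comm] at h

/-- The equation `D_π ∘ 𝒳_π = 𝒳_π ∘ D_π` with the arguments `𝒳(π), a`. -/
theorem twistOne_br_eval (hG : G.IsTopological) (hconv : 𝒳.Converges π) (hπ : G.IsMaurerCartan π)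
    (hN : 𝒳.IsStrongNijenhuis π) {a : L} (ha : a ∈ G.gr (-1)) :
    𝒳.twistOne π (G.br (𝒳.eval π) a) = G.br (𝒳.eval π) (𝒳.twistOne π a) := by
  have h := hconv.comm_twistList hG hπ (hconv.eval_mem hG hπ.1) (b := [a])
    (by simpa using ⟨-1, by decide, ha⟩)
  rw [hN.twistList_eq_zero (l := [𝒳.eval π, a]) (by simp), hconv.dTwist_eval hG hπ,
    hconv.twistList_cons_zero] at h
  simp only [pickSum, pairSum] at h
  rw [hN.twistList_eq_zero (l := [𝒳.eval π]) (by simp),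
    hN.twistList_eq_zero (l := [_, 𝒳.eval π]) (by simp)] at h
  simpa [twistOne_eq_twistList, DGLieAlgebra.dTwist_zero] using h.symm

/-- The equation `D_π ∘ 𝒳_π = 𝒳_π ∘ D_π` with the arguments `[𝒳(π), b], 𝒳(π), a`: here
`𝒳_{π,2}` vanishes on `([𝒳(π), b], a)` for degree reasons, and `[𝒳(π), [𝒳(π), b]] = 0`. -/
theorem twistList_br_eval_br_eval (hG : G.IsTopological) (hGd : G.IsDeformation)
    (hconv : 𝒳.Converges π) (hπ : G.IsMaurerCartan π) (hN : 𝒳.IsStrongNijenhuis π) {a b : L}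
    (ha : a ∈ G.gr (-1)) (hb : b ∈ G.gr (-1)) :
    𝒳.twistList π [G.br (𝒳.eval π) a, G.br (𝒳.eval π) b] = 0 := by
  have he := hconv.eval_mem hG hπ.1
  have hw : G.br (𝒳.eval π) b ∈ G.gr 0 := by simpa using G.br_mem he hb
  have h := hconv.comm_twistList hG hπ hw (b := [𝒳.eval π, a]) (by
    simpa using ⟨⟨1, odd_one, he⟩, ⟨-1, by decide, ha⟩⟩)
  simp only [pickSum, pairSum] at h
  rw [DGLieAlgebra.br_comm_of_odd hw he odd_one,
    DGLieAlgebra.br_br_self_eq_zero he odd_one (br_eval_eval hG hconv hπ hN), smul_zero,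
    hconv.twistList_cons_zero, hconv.dTwist_eval hG hπ, hconv.twistList_cons_zero,
    hconv.twistList_pair_eq_zero hG hGd hπ.1 hw ha,
    hN.twistList_eq_zero (l := [𝒳.eval π, a]) (by simp),
    hN.twistList_eq_zero (l := [_, 𝒳.eval π, a]) (by simp),
    hN.twistList_eq_zero (l := [_, 𝒳.eval π, a]) (by simp),
    hN.twistList_eq_zero (l := [_, 𝒳.eval π]) (by simp),
    hN.twistList_eq_zero (l := [_, _, 𝒳.eval π]) (by simp),
    hN.twistList_eq_zero (l := [_, 𝒳.eval π]) (by simp)] at h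
  simpa [DGLieAlgebra.dTwist_zero] using h.symm

/-- `𝒳_{π,1}` is a derivation of the bracket of `x` with `[𝒳(π), v]`, provided that `d_π x` lies in
the image of `[𝒳(π), -]` and `d_π` annihilates `[𝒳(π), v]`. -/
theorem twistOne_br (hG : G.IsTopological) (hGd : G.IsDeformation)
    (hconv : 𝒳.Converges π) (hπ : G.IsMaurerCartan π) (hN : 𝒳.IsStrongNijenhuis π) {x u v : L}
    (hx : x ∈ G.gr (-1)) (hu : u ∈ G.gr (-1)) (hv : v ∈ G.gr (-1))
    (hxu : G.dTwist π x = G.br (𝒳.eval π) u) (hdv : G.dTwist π (G.br (𝒳.eval π) v) = 0) :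
    𝒳.twistOne π (G.br x (G.br (𝒳.eval π) v)) =
      G.br (𝒳.twistOne π x) (G.br (𝒳.eval π) v)
        + G.br x (𝒳.twistOne π (G.br (𝒳.eval π) v)) := by
  have hw : G.br (𝒳.eval π) v ∈ G.gr 0 := by simpa using G.br_mem (hconv.eval_mem hG hπ.1) hv
  have hcomm : ∀ a ∈ G.gr (-1), (0 - 1 : ℤ).negOnePow • G.br (G.br (𝒳.eval π) v) a =
      G.br a (G.br (𝒳.eval π) v) := fun a ha => by
    rw [DGLieAlgebra.br_comm_of_odd hw ha (by decide), Int.negOnePow_smul_self]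
  have h := hconv.comm_twistList hG hπ hw (b := [x]) (by simpa using ⟨-1, by decide, hx⟩)
  simp only [pickSum, pairSum] at h
  rw [hconv.twistList_pair_eq_zero hG hGd hπ.1 hw hx, hdv, hconv.twistList_cons_zero, hxu,
    twistList_br_eval_br_eval hG hGd hconv hπ hN hu hv, ← twistOne_eq_twistList,
    ← twistOne_eq_twistList, hcomm _ (hconv.twistOne_mem hG hπ.1 hx), add_zero, add_zero,
    add_zero, add_zero, add_zero, ← hconv.twistList_cons_negOnePow_smul, hcomm x hx, ← twistOne_eq_twistList] at h
  simpa [DGLieAlgebra.dTwist_zero] using h.symm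

/-- The iterates of `𝒳_{π,1}` on a `d_π`-closed element of degree `-1` are in general not closed,
but `d_π` maps them into the image of `[𝒳(π), -]`. -/
theorem exists_dTwist_iterate_eq (hG : G.IsTopological) (hconv : 𝒳.Converges π)
    (hπ : G.IsMaurerCartan π) (hN : 𝒳.IsStrongNijenhuis π) {f : L} (hf : f ∈ G.gr (-1))
    (hdf : G.dTwist π f = 0) (k : ℕ) :
    (𝒳.twistOne π)^[k] f ∈ G.gr (-1) ∧
      ∃ u ∈ G.gr (-1), G.dTwist π ((𝒳.twistOne π)^[k] f) = G.br (𝒳.eval π) u := by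
  induction k with
  | zero => exact ⟨hf, 0, zero_mem _, by rw [Function.iterate_zero_apply, hdf, map_zero]⟩
  | succ k ih =>
    obtain ⟨hx, u, hu, hxu⟩ := ih
    rw [Function.iterate_succ_apply']
    refine ⟨hconv.twistOne_mem hG hπ.1 hx, 𝒳.twistOne π u - (𝒳.twistOne π)^[k] f,
      sub_mem (hconv.twistOne_mem hG hπ.1 hu) hx, ?_⟩
    have h := hconv.twistOne_dTwist hG hπ hx
    rw [hxu, twistOne_br_eval hG hconv hπ hN hu] at h
    rw [map_sub, h, add_sub_cancel_right]

end LInftyDerivation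

theorem mainTheorem2 {𝕜 : Type*} {L : Type*} [Field 𝕜] [CharZero 𝕜] [AddCommGroup L] [Module 𝕜 L]
    [TopologicalSpace L] [IsTopologicalAddGroup L] [T2Space L]
    (G : DGLieAlgebra 𝕜 L) (hG : G.IsDeformation) (hGtop : G.IsTopological)
    (𝒳 : LInftyDerivation G) (π : L) (hπ : G.IsMaurerCartan π) (hconv : 𝒳.Converges π)
    (hN : 𝒳.IsStrongNijenhuis π)
    (f g : L) (hf : f ∈ G.gr (-1)) (hg : g ∈ G.gr (-1))
    (hdf : G.dTwist π f = 0) (hdg : G.dTwist π g = 0) (k l : ℕ)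
    (x y : L) (hx : x = (𝒳.twistOne π)^[k] f) (hy : y = (𝒳.twistOne π)^[l] g) :
    𝒳.twistOne π (G.poisson π x y) =
        G.poisson π (𝒳.twistOne π x) y + G.poisson π x (𝒳.twistOne π y)
          + G.br x (G.br (𝒳.eval π) y) ∧
      𝒳.twistOne π (G.br x (G.br (𝒳.eval π) y)) =
        G.br (𝒳.twistOne π x) (G.br (𝒳.eval π) y)
          + G.br x (G.br (𝒳.eval π) (𝒳.twistOne π y)) := by
  obtain ⟨hxm, u, hu, hxu⟩ := LInftyDerivation.exists_dTwist_iterate_eq hGtop hconv hπ hN hf hdf k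
  obtain ⟨hym, v, hv, hyv⟩ := LInftyDerivation.exists_dTwist_iterate_eq hGtop hconv hπ hN hg hdg l
  rw [← hx] at hxm hxu
  rw [← hy] at hym hyv
  have he := hconv.eval_mem hGtop hπ.1
  constructor
  -- `{x, y} = [x, d_π y]` with `d_π y = [𝒳(π), v]`
  · have h := LInftyDerivation.twistOne_br hGtop hG hconv hπ hN hxm hu hv hxu
      (by rw [← hyv, hπ.dTwist_dTwist])
    rw [← hyv, hconv.twistOne_dTwist hGtop hπ hym, map_add,
      DGLieAlgebra.dTwist_eq_br hG hym,
      DGLieAlgebra.dTwist_eq_br hG (hconv.twistOne_mem hGtop hπ.1 hym), ← add_assoc] at h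
    exact h
  · have h := LInftyDerivation.twistOne_br hGtop hG hconv hπ hN hxm hu hym hxu (by
      rw [DGLieAlgebra.dTwist_br_of_odd hπ.1 he odd_one, hconv.dTwist_eval hGtop hπ, hyv,
        DGLieAlgebra.br_br_self_eq_zero he odd_one
          (LInftyDerivation.br_eval_eval hGtop hconv hπ hN), map_zero, LinearMap.zero_apply,
        sub_zero])
    rwa [LInftyDerivation.twistOne_br_eval hGtop hconv hπ hN hym] at h
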